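/- Let $\mathbb{K}=\mathbb{R}$ or $\mathbb{C}$, let $s,q,r$ be real numbers with $1\le q<s$ and $1\le r\le s$, and let $X$ be a Banach space over $\mathbb{K}$ with topological dual $X^*$. For a Banach space $Y$ and $1\le p<\infty$, let $\ell_p(Y)$ denote the space of all sequences $(y_j)_{j=1}^\infty$ in $Y$ with $\sum_{j=1}^\infty\|y_j\|^p<\infty$. Let $\ell^A_{(s,q,r)}(X)$ be the space of all sequences $(x_j)_{j=1}^\infty$ in $X$ such that $$\sum_{j=1}^\infty\Big(\sum_{k=1}^\infty |x_k^*(x_j)|^s\Big)^{q/s}<\infty\qquad\text{for every } (x_k^*)_{k=1}^\infty\in\ell_r(X^*).$$ Then $X$ is finite-dimensional if and only if $\ell^A_{(s,q,r)}(X)=\ell_q(X)$ (as sets of sequences). -/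

import Mathlib

open scoped ENNReal

/-- The space `ℓ_p(X)` of absolutely `p`-summable `X`-valued sequences, as a set of sequences. -/
def absSummableSeq (X : Type*) [NormedAddCommGroup X] (p : ℝ) : Set (ℕ → X) :=
  {x | Memℓp x (ENNReal.ofReal p)}

/-- The space `ℓ^A_{(s,q,r)}(X)` of anisotropic `(s,q,r)`-summable sequences, as a set of
sequences: those `(x_j)` with `∑_j (∑_k |x_k^*(x_j)|^s)^(q/s) < ∞` for every
`(x_k^*) ∈ ℓ_r(X^*)`. The sums are taken in `[0,∞]`. -/
def anisotropicSummableSeq (𝕜 X : Type*) [RCLike 𝕜] [NormedAddCommGroup X] [NormedSpace 𝕜 X]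
    (s q r : ℝ) : Set (ℕ → X) :=
  {x | ∀ φ ∈ absSummableSeq (StrongDual 𝕜 X) r,
    ∑' j, (∑' k, ‖φ k (x j)‖ₑ ^ s) ^ (q / s) < ∞}

/-! Absolute summability always suffices, since `|φ (x)| ≤ ‖φ‖ ‖x‖` and `ℓ_r ⊆ ℓ_s`. In finite
dimension, testing single functionals puts each coordinate in `ℓ_q`. In infinite dimension,
Dvoretzky–Rogers gives, for every `m`, `m` vectors of norm at least `1/8` with weak `ℓ_2` norm at
most `1`. Scaled by `m^(-1/q)`, they keep a `q`-sum bounded below, while their anisotropic sum is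
`O(m^(-q/(2s)))`. Concatenating such blocks separates the two spaces. -/

theorem LinearMap.IsProj.det_one_add_smul {K V : Type*} [Field K] [AddCommGroup V] [Module K V]
    [FiniteDimensional K V] {p : Submodule K V} {f : V →ₗ[K] V} (h : LinearMap.IsProj p f) (c : K) :
    LinearMap.det (1 + c • f) = (1 + c) ^ Module.finrank K p := by
  have key : 1 + c • f = (p.prodEquivOfIsCompl (LinearMap.ker f) h.isCompl).conj
      (LinearMap.prodMap ((1 + c) • LinearMap.id) LinearMap.id) := by
    conv_lhs => rw [h.eq_conj_prodMap]
    rw [← map_smul]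
    have : (1 : V →ₗ[K] V) = (p.prodEquivOfIsCompl (LinearMap.ker f) h.isCompl).conj
        LinearMap.id := by
      rw [LinearEquiv.conj_id]; rfl
    rw [this, ← map_add]
    congr 1
    ext x <;> simp [add_smul]
  rw [key, LinearEquiv.conj_apply, LinearMap.comp_assoc, LinearMap.det_conj, LinearMap.det_prodMap, LinearMap.det_smul]
  simp

/-! ### Dvoretzky–Rogers via maximal determinants -/

section DvoretzkyRogers

variable {𝕜 H X : Type*} [RCLike 𝕜] [NormedAddCommGroup H] [InnerProductSpace 𝕜 H]
  [FiniteDimensional 𝕜 H] [NormedAddCommGroup X] [NormedSpace 𝕜 X]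

theorem exists_isMaxOn_norm_det (L : H →L[𝕜] X) (hL : Function.Injective L) :
    ∃ A : H →L[𝕜] H, ‖L ∘L A‖ ≤ 1 ∧ A.det ≠ 0 ∧
      ∀ B : H →L[𝕜] H, ‖L ∘L B‖ ≤ 1 → ‖B.det‖ ≤ ‖A.det‖ := by
  obtain ⟨K, -, hK⟩ := (L : H →ₗ[𝕜] X).exists_antilipschitzWith (LinearMap.ker_eq_bot.2 hL)
  have : ProperSpace (H →L[𝕜] H) := FiniteDimensional.proper_rclike 𝕜 _
  have hcomp : IsCompact {A : H →L[𝕜] H | ‖L ∘L A‖ ≤ 1} := by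
    refine Metric.isCompact_of_isClosed_isBounded ?_ ?_
    · exact isClosed_le (by fun_prop) continuous_const
    · refine (Metric.isBounded_closedBall (x := (0 : H →L[𝕜] H)) (r := K)).subset ?_
      intro A hA
      rw [mem_closedBall_zero_iff]
      refine A.opNorm_le_bound K.2 fun x => ?_
      have h1 : ‖A x‖ ≤ K * ‖L (A x)‖ := by
        simpa using hK.le_mul_norm (map_zero _) (A x)
      have h2 : ‖L (A x)‖ ≤ 1 * ‖x‖ := (L ∘L A).le_of_opNorm_le hA x
      calc ‖A x‖ ≤ K * ‖L (A x)‖ := h1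
        _ ≤ K * (1 * ‖x‖) := by gcongr
        _ = K * ‖x‖ := by ring
  obtain ⟨A, hA, hmax⟩ := hcomp.exists_isMaxOn ⟨0, by simp⟩
    (ContinuousLinearMap.continuous_det (𝕜 := 𝕜) (E := H)).norm.continuousOn
  refine ⟨A, hA, fun h0 => ?_, fun B hB => hmax hB⟩
  -- A small multiple of the identity is admissible and invertible, so the maximum is not zero.
  set c : ℝ := (1 + ‖L‖)⁻¹ with hc
  have hcpos : 0 < c := by positivity
  have hmem : ‖L ∘L ((c : 𝕜) • ContinuousLinearMap.id 𝕜 H)‖ ≤ 1 := by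
    rw [ContinuousLinearMap.comp_smul, ContinuousLinearMap.comp_id, norm_smul, RCLike.norm_ofReal,
      abs_of_pos hcpos, hc, inv_mul_le_iff₀ (by positivity)]
    linarith
  have := hmax hmem
  simp only [Set.mem_ofPred_eq, h0, norm_zero, norm_le_zero_iff] at this
  simp [ContinuousLinearMap.det, hcpos.ne'] at this

/-- Take `T = L ∘L A` with `A` of maximal determinant. Were `T` below `1/8` on the unit sphere of a
large `F`, stretching `A` along `F` would increase the determinant. -/
theorem exists_forall_submodule_exists_norm_le (L : H →L[𝕜] X) (hL : Function.Injective L)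
    (hH : 0 < Module.finrank 𝕜 H) :
    ∃ T : H →L[𝕜] X, ‖T‖ ≤ 1 ∧ ∀ F : Submodule 𝕜 H,
      Module.finrank 𝕜 H ≤ 2 * Module.finrank 𝕜 F → ∃ e ∈ F, ‖e‖ = 1 ∧ 1 / 8 ≤ ‖T e‖ := by
  obtain ⟨A, hA, hdet, hmax⟩ := exists_isMaxOn_norm_det L hL
  refine ⟨L ∘L A, hA, fun F hF => ?_⟩
  by_contra! hlt
  have hle : ∀ x ∈ F, 8 * ‖L (A x)‖ ≤ ‖x‖ := by
    intro x hx
    rcases eq_or_ne x 0 with rfl | hx0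
    · simp
    have hpos := norm_pos_iff.2 hx0
    have := hlt (((‖x‖⁻¹ : ℝ) : 𝕜) • x) (F.smul_mem _ hx) (by
      rw [norm_smul, RCLike.norm_ofReal, abs_of_pos (by positivity), inv_mul_cancel₀ hpos.ne'])
    rw [map_smul, norm_smul, RCLike.norm_ofReal, abs_of_pos (by positivity),
      inv_mul_lt_iff₀ hpos] at this
    simp only [ContinuousLinearMap.comp_apply] at this
    linarith
  have hproj : LinearMap.IsProj F (F.starProjection : H →ₗ[𝕜] H) :=
    ⟨fun x => F.starProjection_apply_mem x, fun x hx => F.starProjection_eq_self_iff.2 hx⟩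
  -- Stretch by `9` on `F`, then halve to restore norm at most `1`. The determinant changes by
  -- `9^dim F / 2^dim H ≥ (9/4)^dim F > 1`.
  set B : H →L[𝕜] H := ((2⁻¹ : ℝ) : 𝕜) • (A ∘L (1 + (8 : 𝕜) • F.starProjection)) with hB
  have hBn : ‖L ∘L B‖ ≤ 1 := by
    refine ContinuousLinearMap.opNorm_le_bound _ zero_le_one fun x => ?_
    have h1 : ‖L (A x)‖ ≤ 1 * ‖x‖ := (L ∘L A).le_of_opNorm_le hA x
    have h2 := hle _ (F.starProjection_apply_mem x)
    have h3 : ‖F.starProjection x‖ ≤ ‖x‖ := F.norm_starProjection_apply_le x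
    have h4 : (L ∘L B) x = ((2⁻¹ : ℝ) : 𝕜) • (L (A x) + (8 : 𝕜) • L (A (F.starProjection x))) := by
      simp [hB]
    have h5 : ‖L (A x) + (8 : 𝕜) • L (A (F.starProjection x))‖
        ≤ ‖L (A x)‖ + 8 * ‖L (A (F.starProjection x))‖ := by
      refine (norm_add_le _ _).trans ?_
      rw [norm_smul, RCLike.norm_ofNat]
    rw [h4, norm_smul, RCLike.norm_ofReal, abs_of_pos (by norm_num)]
    linarith
  have hBd : B.det = ((2⁻¹ : ℝ) : 𝕜) ^ Module.finrank 𝕜 H *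
      (A.det * (1 + 8) ^ Module.finrank 𝕜 F) := by
    rw [← hproj.det_one_add_smul, ContinuousLinearMap.det, ContinuousLinearMap.det,
      ← LinearMap.det_comp, ← LinearMap.det_smul]
    rfl
  have h := hmax B hBn
  have h9 : ‖(1 + 8 : 𝕜)‖ = 9 := by
    rw [show (1 + 8 : 𝕜) = 9 by norm_num, RCLike.norm_ofNat]
  rw [hBd, norm_mul, norm_mul, norm_pow, norm_pow, RCLike.norm_ofReal, h9,
    abs_of_pos (by norm_num), inv_pow, inv_mul_le_iff₀ (by positivity), mul_comm,
    mul_le_mul_iff_left₀ (norm_pos_iff.2 hdet)] at h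
  have h4 : (9 : ℝ) ^ Module.finrank 𝕜 F ≤ 4 ^ Module.finrank 𝕜 F := by
    refine h.trans ((pow_le_pow_right₀ one_le_two hF).trans_eq ?_)
    rw [pow_mul]; norm_num
  have : Module.finrank 𝕜 F ≠ 0 := by omega
  exact absurd h4 (not_le.2 (pow_lt_pow_left₀ (by norm_num) (by norm_num) this))

/-- Greedy choice: the next vector is taken in the orthogonal complement of the previous ones. -/
theorem exists_orthonormal_forall_mem {S : Set H} {m : ℕ}
    (h : ∀ F : Submodule 𝕜 H, Module.finrank 𝕜 H < Module.finrank 𝕜 F + m →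
      ∃ e ∈ F, ‖e‖ = 1 ∧ e ∈ S) :
    ∃ e : Fin m → H, Orthonormal 𝕜 e ∧ ∀ i, e i ∈ S := by
  induction m with
  | zero => exact ⟨Fin.elim0, ⟨fun i => i.elim0, fun i => i.elim0⟩, fun i => i.elim0⟩
  | succ m ih =>
    obtain ⟨e, he, heS⟩ := ih fun F hF => h F (by omega)
    have hdim := (Submodule.span 𝕜 (Set.range e)).finrank_add_finrank_orthogonal
    rw [finrank_span_eq_card he.linearIndependent, Fintype.card_fin] at hdim
    obtain ⟨v, hvF, hv, hvS⟩ := h (Submodule.span 𝕜 (Set.range e))ᗮ (by omega)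
    have hve : ∀ i, inner 𝕜 (e i) v = 0 := fun i =>
      Submodule.inner_right_of_mem_orthogonal (Submodule.subset_span (Set.mem_range_self i)) hvF
    refine ⟨Fin.cons v e, ⟨?_, ?_⟩, ?_⟩
    · intro i
      refine Fin.cases hv he.1 i
    · intro i j
      refine Fin.cases ?_ (fun i => ?_) i <;> refine Fin.cases ?_ (fun j => ?_) j
      · simp
      · intro _
        exact inner_eq_zero_symm.1 (hve j)
      · intro _
        exact hve i
      · intro hij
        exact he.2 (fun h => hij (congrArg Fin.succ h))
    · intro i
      exact Fin.cases hvS heS i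

end DvoretzkyRogers

/-- The **Dvoretzky–Rogers lemma**. -/
theorem exists_weakly_two_summable_family {𝕜 X : Type*} [RCLike 𝕜] [NormedAddCommGroup X]
    [NormedSpace 𝕜 X] (hX : ¬ FiniteDimensional 𝕜 X) (m : ℕ) :
    ∃ x : Fin m → X, (∀ i, 1 / 8 ≤ ‖x i‖) ∧
      ∀ φ : StrongDual 𝕜 X, ∑ i, ‖φ (x i)‖ ^ 2 ≤ ‖φ‖ ^ 2 := by
  rcases Nat.eq_zero_or_pos m with rfl | hm
  · exact ⟨Fin.elim0, fun i => i.elim0, fun φ => by simp⟩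
  -- In dimension `2 * m`, the complement of fewer than `m` vectors still has at least half the
  -- dimension.
  obtain ⟨v, hv⟩ : ∃ v : Fin (2 * m) → X, LinearIndependent 𝕜 v := by
    have hrank : ((2 * m : ℕ) : Cardinal) ≤ Module.rank 𝕜 X :=
      (Cardinal.natCast_lt_aleph0).le.trans
        (not_lt.1 fun h => hX (Module.rank_lt_aleph0_iff.1 h))
    obtain ⟨t, ht, hli⟩ := exists_finset_linearIndependent_of_le_rank hrank
    exact ⟨_, hli.comp _ (t.equivFinOfCardEq ht).symm.injective⟩
  let L₀ : EuclideanSpace 𝕜 (Fin (2 * m)) →ₗ[𝕜] X :=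
    Fintype.linearCombination 𝕜 v ∘ₗ (WithLp.linearEquiv 2 𝕜 (Fin (2 * m) → 𝕜)).toLinearMap
  have hL₀ : Function.Injective L₀ :=
    (linearIndependent_iff_injective_fintypeLinearCombination.1 hv).comp (WithLp.linearEquiv 2 𝕜 _).injective
  have hdim : Module.finrank 𝕜 (EuclideanSpace 𝕜 (Fin (2 * m))) = 2 * m := by simp
  obtain ⟨T, hT, hTF⟩ := exists_forall_submodule_exists_norm_le (LinearMap.toContinuousLinearMap L₀)
    hL₀ (by omega)
  obtain ⟨e, he, heT⟩ := exists_orthonormal_forall_mem (S := {e | 1 / 8 ≤ ‖T e‖}) (m := m)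
    (fun F hF => hTF F (by omega))
  refine ⟨fun i => T (e i), heT, fun φ => ?_⟩
  -- The Riesz representative turns the weak `ℓ_2` bound into Bessel's inequality.
  set y := (InnerProductSpace.toDual 𝕜 (EuclideanSpace 𝕜 (Fin (2 * m)))).symm (φ ∘L T) with hy
  have hφ : ∀ i, ‖φ (T (e i))‖ = ‖inner 𝕜 (e i) y‖ := fun i => by
    rw [norm_inner_symm, hy, InnerProductSpace.toDual_symm_apply]; rfl
  simp only [hφ]
  refine (he.sum_inner_products_le y (s := Finset.univ)).trans ?_
  rw [hy, LinearIsometryEquiv.norm_map]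
  gcongr
  exact (φ.opNorm_comp_le T).trans (mul_le_of_le_one_right (norm_nonneg _) hT)

/-! ### The inclusions between the two sequence spaces -/

theorem memℓp_ofReal_iff_tsum_enorm {ι Y : Type*} [NormedAddCommGroup Y] {p : ℝ} (hp : 0 < p)
    {x : ι → Y} : Memℓp x (ENNReal.ofReal p) ↔ ∑' j, ‖x j‖ₑ ^ p < ∞ := by
  have h : ∀ j, ‖x j‖ₑ ^ p = ENNReal.ofReal (‖x j‖ ^ p) := fun j => by
    rw [← ofReal_norm, ENNReal.ofReal_rpow_of_nonneg (norm_nonneg _) hp.le]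
  rw [memℓp_gen_iff (by rwa [ENNReal.toReal_ofReal hp.le]), ENNReal.toReal_ofReal hp.le]
  simp only [h]
  refine ⟨fun hs => hs.tsum_ofReal_lt_top, fun hs => ?_⟩
  have := ENNReal.summable_toReal hs.ne
  refine this.congr fun j => ?_
  rw [ENNReal.toReal_ofReal (by positivity)]

theorem mem_absSummableSeq_iff {Y : Type*} [NormedAddCommGroup Y] {p : ℝ} (hp : 0 < p)
    {x : ℕ → Y} : x ∈ absSummableSeq Y p ↔ ∑' j, ‖x j‖ₑ ^ p < ∞ :=
  memℓp_ofReal_iff_tsum_enorm hp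

theorem absSummableSeq_mono {Y : Type*} [NormedAddCommGroup Y] {r s : ℝ} (hrs : r ≤ s) :
    absSummableSeq Y r ⊆ absSummableSeq Y s :=
  fun _ hx => Memℓp.of_exponent_ge hx (ENNReal.ofReal_le_ofReal hrs)

section

variable {𝕜 X : Type*} [RCLike 𝕜] [NormedAddCommGroup X] [NormedSpace 𝕜 X] {s q r : ℝ}

theorem absSummableSeq_subset_anisotropicSummableSeq (hq : 0 < q) (hs : 0 < s) (hrs : r ≤ s) :
    absSummableSeq X q ⊆ anisotropicSummableSeq 𝕜 X s q r := by
  intro x hx φ hφ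
  have hφs := (mem_absSummableSeq_iff hs).1 (absSummableSeq_mono hrs hφ)
  rw [mem_absSummableSeq_iff hq] at hx
  have hle : ∀ j, (∑' k, ‖φ k (x j)‖ₑ ^ s) ^ (q / s)
      ≤ (∑' k, ‖φ k‖ₑ ^ s) ^ (q / s) * ‖x j‖ₑ ^ q := fun j => by
    calc (∑' k, ‖φ k (x j)‖ₑ ^ s) ^ (q / s)
        ≤ (∑' k, ‖φ k‖ₑ ^ s * ‖x j‖ₑ ^ s) ^ (q / s) := by
          gcongr with k
          rw [← ENNReal.mul_rpow_of_nonneg _ _ hs.le]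
          gcongr
          exact (φ k).le_opENorm (x j)
      _ = (∑' k, ‖φ k‖ₑ ^ s) ^ (q / s) * ‖x j‖ₑ ^ q := by
          rw [ENNReal.tsum_mul_right, ENNReal.mul_rpow_of_nonneg _ _ (by positivity),
            ← ENNReal.rpow_mul, mul_div_cancel₀ _ hs.ne']
  refine (ENNReal.tsum_le_tsum hle).trans_lt ?_
  rw [ENNReal.tsum_mul_left]
  exact ENNReal.mul_lt_top (ENNReal.rpow_lt_top_of_nonneg (by positivity) hφs.ne) hx

theorem tsum_enorm_apply_rpow_lt_top (hs : 0 < s) (hr : 0 < r) {x : ℕ → X}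
    (hx : x ∈ anisotropicSummableSeq 𝕜 X s q r) (f : StrongDual 𝕜 X) :
    ∑' j, ‖f (x j)‖ₑ ^ q < ∞ := by
  have hf : Pi.single 0 f ∈ absSummableSeq (StrongDual 𝕜 X) r := by
    rw [mem_absSummableSeq_iff hr, tsum_eq_single 0 fun k hk => by
      simp [Pi.single_eq_of_ne hk, hr]]
    exact ENNReal.rpow_lt_top_of_nonneg hr.le enorm_ne_top
  refine lt_of_eq_of_lt (tsum_congr fun j => ?_) (hx _ hf)
  rw [tsum_eq_single 0 fun k hk => by
    rw [Pi.single_eq_of_ne hk, zero_apply, enorm_zero, ENNReal.zero_rpow_of_pos hs],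
    Pi.single_eq_same, ← ENNReal.rpow_mul, mul_div_cancel₀ _ hs.ne']

theorem anisotropicSummableSeq_subset_absSummableSeq [FiniteDimensional 𝕜 X] (hq : 0 < q)
    (hs : 0 < s) (hr : 0 < r) : anisotropicSummableSeq 𝕜 X s q r ⊆ absSummableSeq X q := by
  intro x hx
  let b := Module.finBasis 𝕜 X
  have hsum : x = fun j => ∑ i, b.coord i (x j) • b i := by
    funext j
    exact (b.sum_repr (x j)).symm
  rw [hsum]
  refine Memℓp.finsetSum (E := fun _ : ℕ => X) Finset.univ
    (f := fun i j => b.coord i (x j) • b i) fun i _ => ?_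
  rw [memℓp_ofReal_iff_tsum_enorm hq]
  simp only [enorm_smul, ENNReal.mul_rpow_of_nonneg _ _ hq.le]
  rw [ENNReal.tsum_mul_right]
  exact ENNReal.mul_lt_top
    (tsum_enorm_apply_rpow_lt_top hs hr hx (LinearMap.toContinuousLinearMap (b.coord i)))
    (ENNReal.rpow_lt_top_of_nonneg hq.le enorm_ne_top)

/-- Cauchy–Schwarz handles one power and gives `√m`; the other `s - 1` powers are bounded termwise.
This covers all `s ≥ 1` at once, including `s < 2`. -/
theorem sum_norm_rpow_le_sqrt_mul {m : ℕ} {x : Fin m → X}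
    (hx : ∀ φ : StrongDual 𝕜 X, ∑ i, ‖φ (x i)‖ ^ 2 ≤ ‖φ‖ ^ 2) (hs : 1 ≤ s) (φ : StrongDual 𝕜 X) :
    ∑ i, ‖φ (x i)‖ ^ s ≤ √m * ‖φ‖ ^ s := by
  have hle : ∀ i, ‖φ (x i)‖ ≤ ‖φ‖ := fun i =>
    pow_le_pow_iff_left₀ (norm_nonneg _) (norm_nonneg _) two_ne_zero |>.1 ((Finset.single_le_sum (f := fun i => ‖φ (x i)‖ ^ 2)
      (fun _ _ => by positivity) (Finset.mem_univ i)).trans (hx φ))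
  have hsum : ∑ i, ‖φ (x i)‖ ≤ √m * ‖φ‖ := by
    refine (pow_le_pow_iff_left₀ (Finset.sum_nonneg fun _ _ => norm_nonneg _) (by positivity)
      two_ne_zero).1 ?_
    rw [mul_pow, Real.sq_sqrt (Nat.cast_nonneg _)]
    refine (sq_sum_le_card_mul_sum_sq).trans ?_
    rw [Finset.card_univ, Fintype.card_fin]
    gcongr
    exact hx φ
  have hsplit : ∀ t : ℝ, 0 ≤ t → t ^ s = t * t ^ (s - 1) := fun t ht => by
    conv_rhs => rw [← Real.rpow_one t, ← Real.rpow_mul ht, one_mul]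
    rw [← Real.rpow_add_of_nonneg ht zero_le_one (by linarith), add_sub_cancel]
  calc ∑ i, ‖φ (x i)‖ ^ s ≤ ∑ i, ‖φ (x i)‖ * ‖φ‖ ^ (s - 1) := by
        gcongr with i
        rw [hsplit _ (norm_nonneg _)]
        gcongr
        exact hle i
    _ = (∑ i, ‖φ (x i)‖) * ‖φ‖ ^ (s - 1) := by rw [Finset.sum_mul]
    _ ≤ √m * ‖φ‖ * ‖φ‖ ^ (s - 1) := by gcongr
    _ = √m * ‖φ‖ ^ s := by rw [hsplit _ (norm_nonneg φ)]; ring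

theorem sum_enorm_rpow_le_sqrt_mul {m : ℕ} {x : Fin m → X}
    (hx : ∀ φ : StrongDual 𝕜 X, ∑ i, ‖φ (x i)‖ ^ 2 ≤ ‖φ‖ ^ 2) (hs : 1 ≤ s) (φ : StrongDual 𝕜 X) :
    ∑ i, ‖φ (x i)‖ₑ ^ s ≤ ENNReal.ofReal (√m) * ‖φ‖ₑ ^ s := by
  have h := ENNReal.ofReal_le_ofReal (sum_norm_rpow_le_sqrt_mul hx hs φ)
  rw [ENNReal.ofReal_sum_of_nonneg fun _ _ => by positivity,
    ENNReal.ofReal_mul (Real.sqrt_nonneg _)] at h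
  simpa only [← ENNReal.ofReal_rpow_of_nonneg (norm_nonneg _) (zero_le_one.trans hs),
    ofReal_norm] using h

theorem ENNReal.sum_rpow_le_card_rpow_mul {ι : Type*} (t : Finset ι) (a : ι → ℝ≥0∞) {θ : ℝ}
    (hθ : 0 < θ) (hθ1 : θ ≤ 1) :
    ∑ i ∈ t, a i ^ θ ≤ (t.card : ℝ≥0∞) ^ (1 - θ) * (∑ i ∈ t, a i) ^ θ := by
  have h := ENNReal.rpow_sum_le_const_mul_sum_rpow t (fun i => a i ^ θ) (one_le_inv₀ hθ |>.2 hθ1)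
  simp only [ENNReal.rpow_rpow_inv hθ.ne'] at h
  have h2 := ENNReal.rpow_le_rpow h hθ.le
  rw [ENNReal.rpow_inv_rpow hθ.ne', ENNReal.mul_rpow_of_nonneg _ _ hθ.le, ← ENNReal.rpow_mul,
    sub_mul, inv_mul_cancel₀ hθ.ne', one_mul] at h2
  exact h2

/-- In an infinite-dimensional space there are finite families whose absolute `q`-sums are bounded
below while their anisotropic sums are arbitrarily small. -/
theorem exists_family_anisotropic_le (hX : ¬ FiniteDimensional 𝕜 X) (hq : 0 < q) (hs : 1 ≤ s)
    (hqs : q ≤ s) {ε : ℝ} (hε : 0 < ε) :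
    ∃ n : ℕ, ∃ y : Fin (n + 1) → X, ENNReal.ofReal ((1 / 8) ^ q) ≤ ∑ i, ‖y i‖ₑ ^ q ∧
      ∀ φ : ℕ → StrongDual 𝕜 X, ∑ i, (∑' k, ‖φ k (y i)‖ₑ ^ s) ^ (q / s)
        ≤ ENNReal.ofReal ε * (∑' k, ‖φ k‖ₑ ^ s) ^ (q / s) := by
  have hs0 : 0 < s := by linarith
  have hθ : 0 < q / s := by positivity
  have hθ1 : q / s ≤ 1 := (div_le_one hs0).2 hqs
  obtain ⟨n, hn⟩ : ∃ n : ℕ, ((n : ℝ) + 1) ^ (-(q / s / 2)) ≤ ε := by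
    have h1 : Filter.Tendsto (fun n : ℕ => ((n : ℝ) + 1) ^ (-(q / s / 2))) Filter.atTop (nhds 0) :=
      (tendsto_rpow_neg_atTop (by positivity)).comp
        (Filter.tendsto_atTop_add_const_right _ _ tendsto_natCast_atTop_atTop)
    exact (h1.eventually_le_const hε).exists
  obtain ⟨x, hx1, hx2⟩ := exists_weakly_two_summable_family hX (n + 1)
  have hM : (0 : ℝ) < (n : ℝ) + 1 := by positivity
  set M : ℝ := (n : ℝ) + 1 with hMdef
  have hcast : ((n + 1 : ℕ) : ℝ) = M := by push_cast; rfl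
  have hcastE : ((n + 1 : ℕ) : ℝ≥0∞) = ENNReal.ofReal M := by
    rw [← hcast, ENNReal.ofReal_natCast]
  -- Chosen so that `|c|^q = 1/M`, which averages the `q`-th powers over the `M` vectors.
  set c : 𝕜 := ((M ^ (-q⁻¹) : ℝ) : 𝕜) with hc
  have hcn : ‖c‖ₑ ^ q = ENNReal.ofReal M⁻¹ := by
    rw [hc, ← ofReal_norm, RCLike.norm_ofReal, abs_of_pos (by positivity),
      ENNReal.ofReal_rpow_of_nonneg (by positivity) hq.le, ← Real.rpow_mul hM.le, neg_mul,
      inv_mul_cancel₀ hq.ne', Real.rpow_neg_one]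
  refine ⟨n, fun i => c • x i, ?_, fun φ => ?_⟩
  · have hle : ∀ i, ENNReal.ofReal M⁻¹ * ENNReal.ofReal ((1 / 8) ^ q) ≤ ‖c • x i‖ₑ ^ q := fun i => by
      rw [enorm_smul, ENNReal.mul_rpow_of_nonneg _ _ hq.le, hcn,
        ← ENNReal.ofReal_rpow_of_nonneg (by positivity) hq.le, ← ofReal_norm (x i)]
      gcongr
      exact hx1 i
    refine le_trans (le_of_eq ?_) (Finset.sum_le_sum fun i _ => hle i)
    rw [Finset.sum_const, Finset.card_univ, Fintype.card_fin, nsmul_eq_mul, hcastE, ← mul_assoc,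
      ← ENNReal.ofReal_mul hM.le, mul_inv_cancel₀ hM.ne', ENNReal.ofReal_one, one_mul]
  · set A := ∑' k, ‖φ k‖ₑ ^ s
    have h1 : ∀ i, (∑' k, ‖φ k (c • x i)‖ₑ ^ s) ^ (q / s)
        = ENNReal.ofReal M⁻¹ * (∑' k, ‖φ k (x i)‖ₑ ^ s) ^ (q / s) := fun i => by
      simp only [map_smul, enorm_smul, ENNReal.mul_rpow_of_nonneg _ _ hs0.le]
      rw [ENNReal.tsum_mul_left, ENNReal.mul_rpow_of_nonneg _ _ hθ.le, ← ENNReal.rpow_mul,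
        mul_div_cancel₀ _ hs0.ne', hcn]
    have h2 : ∑ i, ∑' k, ‖φ k (x i)‖ₑ ^ s ≤ ENNReal.ofReal (√M) * A := by
      rw [← Summable.tsum_finsetSum fun _ _ => ENNReal.summable, ← ENNReal.tsum_mul_left]
      refine ENNReal.tsum_le_tsum fun k => ?_
      rw [← hcast]
      exact sum_enorm_rpow_le_sqrt_mul hx2 hs (φ k)
    -- The factors come from the scaling, from Hölder over `M` terms, and from the `√M` bound.
    have hexp : M⁻¹ * (M ^ (1 - q / s) * √M ^ (q / s)) = M ^ (-(q / s / 2)) := by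
      rw [Real.sqrt_eq_rpow, ← Real.rpow_mul hM.le, ← Real.rpow_neg_one, ← Real.rpow_add hM,
        ← Real.rpow_add hM]
      congr 1
      ring
    calc ∑ i, (∑' k, ‖φ k (c • x i)‖ₑ ^ s) ^ (q / s)
        = ENNReal.ofReal M⁻¹ * ∑ i, (∑' k, ‖φ k (x i)‖ₑ ^ s) ^ (q / s) := by
          simp only [h1, Finset.mul_sum]
      _ ≤ ENNReal.ofReal M⁻¹ * (ENNReal.ofReal M ^ (1 - q / s) *
            (ENNReal.ofReal (√M) * A) ^ (q / s)) := by
          gcongr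
          refine (ENNReal.sum_rpow_le_card_rpow_mul _ _ hθ hθ1).trans ?_
          rw [Finset.card_univ, Fintype.card_fin, hcastE]
          gcongr
      _ = ENNReal.ofReal (M ^ (-(q / s / 2))) * A ^ (q / s) := by
          rw [ENNReal.mul_rpow_of_nonneg _ _ hθ.le,
            ENNReal.ofReal_rpow_of_nonneg hM.le (by linarith),
            ENNReal.ofReal_rpow_of_nonneg (by positivity) hθ.le, ← mul_assoc, ← mul_assoc,
            ← ENNReal.ofReal_mul (by positivity), ← ENNReal.ofReal_mul (by positivity), mul_assoc,
            hexp]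
      _ ≤ ENNReal.ofReal ε * A ^ (q / s) := by gcongr

theorem exists_mem_anisotropicSummableSeq_notMem_absSummableSeq (hX : ¬ FiniteDimensional 𝕜 X)
    (hq : 0 < q) (hs : 1 ≤ s) (hqs : q ≤ s) (hrs : r ≤ s) :
    ∃ x ∈ anisotropicSummableSeq 𝕜 X s q r, x ∉ absSummableSeq X q := by
  have hs0 : 0 < s := by linarith
  -- Block `N` has anisotropic weight `2^(-N)`, which is summable, but `q`-sum at least `(1/8)^q`.
  choose n y hy1 hy2 using fun N : ℕ =>
    exists_family_anisotropic_le hX hq hs hqs (ε := (1 / 2) ^ N) (by positivity)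
  obtain ⟨e⟩ : Nonempty (ℕ ≃ Σ N : ℕ, Fin (n N + 1)) := by
    have : Infinite (Σ N : ℕ, Fin (n N + 1)) :=
      Infinite.of_injective (fun N => (⟨N, 0⟩ : Σ N : ℕ, Fin (n N + 1)))
        fun _ _ h => congrArg Sigma.fst h
    infer_instance
  refine ⟨fun j => y (e j).1 (e j).2, fun φ hφ => ?_, fun hmem => ?_⟩
  · have hφs := (mem_absSummableSeq_iff hs0).1 (absSummableSeq_mono hrs hφ)
    rw [e.tsum_eq fun p : Σ N : ℕ, Fin (n N + 1) => (∑' k, ‖φ k (y p.1 p.2)‖ₑ ^ s) ^ (q / s),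
      ENNReal.tsum_sigma']
    simp only [tsum_fintype]
    refine (ENNReal.tsum_le_tsum fun N => hy2 N φ).trans_lt ?_
    rw [ENNReal.tsum_mul_right]
    exact ENNReal.mul_lt_top summable_geometric_two.tsum_ofReal_lt_top
      (ENNReal.rpow_lt_top_of_nonneg (by positivity) hφs.ne)
  · rw [mem_absSummableSeq_iff hq,
      e.tsum_eq fun p : Σ N : ℕ, Fin (n N + 1) => ‖y p.1 p.2‖ₑ ^ q, ENNReal.tsum_sigma'] at hmem
    simp only [tsum_fintype] at hmem
    have h := (ENNReal.tsum_le_tsum hy1).trans_lt hmem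
    rw [ENNReal.tsum_const_eq_top_of_ne_zero
      (ENNReal.ofReal_pos.2 (by positivity)).ne'] at h
    exact lt_irrefl _ h

end

theorem theorem2p6 (𝕜 : Type*) [RCLike 𝕜] (X : Type*) [NormedAddCommGroup X] [NormedSpace 𝕜 X]
    [CompleteSpace X] (s q r : ℝ) (hq : 1 ≤ q) (hr : 1 ≤ r) (hqs : q < s) (hrs : r ≤ s) :
    FiniteDimensional 𝕜 X ↔ anisotropicSummableSeq 𝕜 X s q r = absSummableSeq X q := by
  have hq0 : 0 < q := by linarith
  have hs0 : 0 < s := by linarith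
  refine ⟨fun _ => (anisotropicSummableSeq_subset_absSummableSeq hq0 hs0 (by linarith)).antisymm
    (absSummableSeq_subset_anisotropicSummableSeq hq0 hs0 hrs), fun h => ?_⟩
  by_contra hX
  obtain ⟨x, hx, hx'⟩ := exists_mem_anisotropicSummableSeq_notMem_absSummableSeq hX hq0
    (r := r) (by linarith : 1 ≤ s) hqs.le hrs
  exact hx' (h ▸ hx)
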